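/- A skew Dyck path is a word in the letters $U,D,L$ (up steps $(1,1)$, down steps $(1,-1)$, left steps $(-1,-1)$) in which neither $UL$ nor $LU$ occurs as a contiguous subword (factor), in which the number of $U$s equals the total number of $D$s and $L$s, and no prefix of which contains more $D$s and $L$s in total than $U$s. Its semilength is its number of $U$s. For integers $k\ge 1$ and $n\ge 1$, a $k$-box path of size $n$ is a skew Dyck path of semilength $(k+2)n-1$ with exactly $n$ factors $UD^kL$. For $k=0$, a $0$-box path of size $n\ge 1$ is a word $\mu UL$, where $\mu$ is obtained from a Dyck path of semilength $n-1$ (with steps $U,D$) by replacing each $D$ by $ULD$. A long ascent is a maximal block of consecutive $U$s of length at least $2$. Let $k\ge 0$ and $n\ge 1$ be integers with $(k,n)\ne(0,1)$. Among all $k$-box paths of size $n$ (each equally likely), the mean number of long ascents is $$\frac{n((k+1)n-1)}{(k+2)n-2},$$ and the variance of the number of long ascents is $$\frac{((k+1)n-1)((k+1)n-2)\,n(n-1)}{((k+2)n-2)^2((k+2)n-3)}$$ if $(k,n)\neq(1,1)$, and $0$ if $(k,n)=(1,1)$ (where the last expression reads $0/0$). -/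

import Mathlib

namespace BoxPath

/-- The steps `U = (1, 1)`, `D = (1, -1)` and `L = (-1, -1)`. -/
inductive Step
  | U
  | D
  | L
  deriving DecidableEq

open Step

instance : Fintype Step where
  elems := {U, D, L}
  complete := by intro s; cases s <;> simp

/-- Skew Dyck paths, as words in `U`, `D`, `L`: the factors `UL` and `LU` do not occur, there are as
many up steps as down and left steps together, and the path never goes below the `x`-axis. -/
structure IsSkewDyckPath (w : List Step) : Prop where
  not_UL : ¬ [U, L] <:+: w
  not_LU : ¬ [L, U] <:+: w
  count_eq : w.count U = w.count D + w.count L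
  prefix_le : ∀ p : List Step, p <+: w → p.count D + p.count L ≤ p.count U

/-- The number of occurrences of the (nonempty) word `v` as a factor (contiguous subword) of `w`. -/
def factorCount (v w : List Step) : ℕ :=
  w.tails.countP (fun s => decide (v <+: s))

/-- The word `U D^k L`. -/
def boxFactor (k : ℕ) : List Step :=
  [U] ++ List.replicate k D ++ [L]

/-- The word obtained from a Dyck path by replacing each down step with `ULD`. -/
def augment (d : DyckWord) : List Step :=
  d.toList.flatMap fun s =>
    match s with
    | DyckStep.U => [U]
    | DyckStep.D => [U, L, D]

/-- `w` is a `k`-box path of size `n`.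

For `k ≥ 1`: a skew Dyck path of semilength `(k + 2) n - 1` (the semilength is the number of up
steps) with exactly `n` factors `U D^k L`.

For `k = 0`, where `UL`-factors have to be allowed: a word `μ U L`, with `μ` obtained from a Dyck
path of semilength `n - 1` by replacing each down step with `ULD`. -/
def IsBoxPath : ℕ → ℕ → List Step → Prop
  | 0, n, w => ∃ d : DyckWord, d.semilength + 1 = n ∧ w = augment d ++ [U, L]
  | k + 1, n, w => IsSkewDyckPath w ∧ w.count U + 1 = (k + 1 + 2) * n ∧
      factorCount (boxFactor (k + 1)) w = n

/-- The number of long ascents of a word: the non-`U` steps cut the word into its ascents (and some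
empty blocks), and the blocks with at least two up steps are counted. -/
def longAscents (w : List Step) : ℕ :=
  (w.splitOnP (fun s => s != U)).countP (fun r => decide (2 ≤ r.length))

theorem length_eq_count (w : List Step) : w.length = w.count U + w.count D + w.count L := by
  induction w with
  | nil => rfl
  | cons a t ih => cases a <;> simp [ih] <;> omega

theorem length_augment_le (l : List DyckStep) :
    (l.flatMap fun s =>
      match s with
      | DyckStep.U => [U]
      | DyckStep.D => [U, L, D]).length ≤ 3 * l.length := by
  induction l with
  | nil => simp
  | cons a t ih => cases a <;> simp only [List.flatMap_cons, List.length_append,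
      List.length_cons, List.length_nil] <;> omega

theorem finite_isBoxPath (k n : ℕ) : {w : List Step | IsBoxPath k n w}.Finite := by
  refine (List.finite_length_le Step (6 * ((k + 2) * n) + 2)).subset ?_
  intro w hw
  cases k with
  | zero =>
    obtain ⟨d, hd, rfl⟩ := hw
    have h1 := length_augment_le d.toList
    have h2 := d.two_mul_semilength_eq_length
    simp only [Set.mem_ofPred_eq, augment, List.length_append, List.length_cons, List.length_nil]
    omega
  | succ k =>
    obtain ⟨h, hc, -⟩ := hw
    have h1 := length_eq_count w
    have h2 := h.count_eq
    simp only [Set.mem_ofPred_eq]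
    omega

/-- The finite set of `k`-box paths of size `n`. -/
noncomputable def boxPaths (k n : ℕ) : Finset (List Step) :=
  (finite_isBoxPath k n).toFinset

/-- The average of `f` over the finite set `S`. -/
def mean {α : Type*} (S : Finset α) (f : α → ℚ) : ℚ :=
  (∑ a ∈ S, f a) / (S.card : ℚ)

/-- The (population) variance of `f` over the finite set `S`. -/
def variance {α : Type*} (S : Finset α) (f : α → ℚ) : ℚ :=
  mean S fun a => (f a - mean S f) ^ 2

end BoxPath

/-!
Let `X` stand for the word `U D^k L D`. A `k`-box path of size `n` is the same thing as a word `v`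
in `U` and `X`, followed by a last `U D^k L`, where `v` has `n - 1` letters `X` and, with `U`
counting as a step `+1` and `X` as a step `-(k + 1)`, never goes below `0` and ends at height `k`
(`isBoxPath_iff`). For `k = 0` this is the definition. For `k ≥ 1` it holds because `(k + 2) n - 1`
is the least semilength possible: since `LU` is excluded, each factor `U D^k L` but a final one is
followed by another down or left step, so `n` of them need `(k + 2) n - 1` such steps, and when
there are no others the path is cut into `U`s and `X`s (`factorCount_le_and_eq`).

Each ascent of the path ends with the `U` of a box `U D^k L`, and it is long when the letter of `v`
before this box is a `U`. So the long ascents are the peaks of `v`, a final `U` counting as one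
(`longAscents_toPath`). The words `v`, sorted by height and peaks, satisfy a linear recursion in the
last letter, which is solved by
`n * #{v with n letters X, final height r - 1, i + 1 factors UX} =
  r * n.choose (i + 1) * ((k + 1) * n + r - 1).choose i`
(`peakCount_false_formula`). It follows that `(n.choose j) * (((k + 1) * n - 2).choose (j - 1)) / n`
of the `k`-box paths of size `n` have `j` long ascents (`sum_peaks`). This is a hypergeometric
distribution, with a sample of `(k + 1) * n - 1` from a population of `(k + 2) * n - 2` in which `n`
elements are marked, and the mean and the variance come from Vandermonde's identity
(`mean_variance_of_hypergeometric`).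
-/

namespace BoxPath

open Step

/-! ### Raney words and their enumeration by peaks -/

/-- The reversals of the words over `{U, D}` with `n` letters `D` in which `U` raises the height by
`1`, `D` lowers it by `k + 1`, no prefix ends below height `0`, and the final height is `r - 1`.
Words are stored backwards, so that `List.cons` adds a last step. The height is shifted by one so
that the set for `r = 0` (a final height of `-1`) is empty, which makes the recursion uniform. -/
def raneyWords (k : ℕ) : ℕ → ℕ → Finset (List DyckStep)
  | _, 0 => ∅
  | 0, 1 => {[]}
  | 0, r + 2 => (raneyWords k 0 (r + 1)).map ⟨List.cons .U, List.cons_injective⟩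
  | n + 1, r + 1 => (raneyWords k (n + 1) r).map ⟨List.cons .U, List.cons_injective⟩ ∪
      (raneyWords k n (r + k + 2)).map ⟨List.cons .D, List.cons_injective⟩
termination_by n r => (n, r)

/-- The number of factors `UD` of the word with reversal `s`, where the flag `b` says whether that
word is followed by a further `D`. -/
def peaks : Bool → List DyckStep → ℕ
  | _, [] => 0
  | b, .U :: s => (if b then 1 else 0) + peaks false s
  | _, .D :: s => peaks true s

theorem sum_raneyWords_succ {M : Type*} [AddCommMonoid M] (k n r : ℕ) (f : List DyckStep → M) :
    ∑ s ∈ raneyWords k (n + 1) (r + 1), f s =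
      ∑ s ∈ raneyWords k (n + 1) r, f (.U :: s) +
        ∑ s ∈ raneyWords k n (r + k + 2), f (.D :: s) := by
  rw [raneyWords, Finset.sum_union, Finset.sum_map, Finset.sum_map]
  · rfl
  · rw [Finset.disjoint_left]
    intro s hs ht
    simp only [Finset.mem_map, Function.Embedding.coeFn_mk] at hs ht
    obtain ⟨a, -, rfl⟩ := hs
    obtain ⟨b, -, hb⟩ := ht
    cases hb

theorem sum_raneyWords_zero {M : Type*} [AddCommMonoid M] (k r : ℕ) (f : List DyckStep → M) :
    ∑ s ∈ raneyWords k 0 (r + 2), f s = ∑ s ∈ raneyWords k 0 (r + 1), f (.U :: s) := by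
  rw [raneyWords, Finset.sum_map]
  rfl

theorem mem_raneyWords (k : ℕ) (s : List DyckStep) : ∀ n r : ℕ,
    s ∈ raneyWords k n (r + 1) ↔
      s.count .D = n ∧ s.count .U = (k + 1) * n + r ∧
        ∀ t, t <:+ s → (k + 1) * t.count .D ≤ t.count .U := by
  induction s with
  | nil =>
    rintro (_ | n) (_ | r) <;> simp [raneyWords]
  | cons a s ih =>
    have suff (P : List DyckStep → Prop) : (∀ t, t <:+ a :: s → P t) ↔
        P (a :: s) ∧ ∀ t, t <:+ s → P t := by
      simp [List.suffix_cons_iff]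
    intro n r
    rw [suff]
    cases a with
    | U =>
      have h1 : DyckStep.U :: s ∈ raneyWords k n (r + 1) ↔ s ∈ raneyWords k n r := by
        rcases n with _ | n <;> rcases r with _ | r <;> simp [raneyWords]
      rw [h1]
      rcases r with _ | r
      · simp only [raneyWords, Finset.notMem_empty, false_iff]
        rintro ⟨h1, h2, -, h3⟩
        have := h3 s List.suffix_rfl
        simp at h1 h2
        rw [h1] at this
        omega
      · rw [ih]
        simp only [List.count_cons_self, List.count_cons_of_ne, ne_eq, reduceCtorEq,
          not_false_eq_true]
        constructor
        · rintro ⟨h1, h2, h3⟩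
          refine ⟨h1, by omega, ?_, h3⟩
          rw [h1, h2]
          omega
        · rintro ⟨h1, h2, -, h3⟩
          exact ⟨h1, by omega, h3⟩
    | D =>
      rcases n with _ | n
      · rcases r with _ | r <;> simp [raneyWords]
      · have h1 : DyckStep.D :: s ∈ raneyWords k (n + 1) (r + 1) ↔
            s ∈ raneyWords k n (r + k + 2) := by
          simp [raneyWords]
        rw [h1, show r + k + 2 = (r + k + 1) + 1 from rfl, ih]
        simp only [List.count_cons_self, List.count_cons_of_ne, ne_eq, reduceCtorEq,
          not_false_eq_true, Nat.add_right_cancel_iff]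
        constructor
        · rintro ⟨h1, h2, h3⟩
          refine ⟨h1, by rw [h2]; ring, ?_, h3⟩
          rw [h1, h2]
          nlinarith
        · rintro ⟨h1, h2, -, h3⟩
          exact ⟨h1, by rw [h2]; ring, h3⟩

/-- The Kronecker delta, with rational values. -/
def delta (j m : ℕ) : ℚ := if m = j then 1 else 0

/-- The number of words in `raneyWords k n r` with `j` peaks, the flag `b` being that of `peaks`. -/
def peakCount (k : ℕ) (b : Bool) (j n r : ℕ) : ℚ :=
  ∑ s ∈ raneyWords k n r, delta j (peaks b s)

@[simp] theorem peakCount_zero_right (k : ℕ) (b : Bool) (j n : ℕ) : peakCount k b j n 0 = 0 := by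
  cases n <;> simp [peakCount, raneyWords]

theorem delta_succ_one_add (j m : ℕ) :
    delta (j + 1) (1 + m) = delta j m := by
  simp [delta, add_comm 1]

theorem delta_zero_one_add (m : ℕ) : delta 0 (1 + m) = 0 := by
  simp [delta, add_comm 1]

theorem peakCount_false_succ (k j n r : ℕ) :
    peakCount k false j (n + 1) (r + 1) =
      peakCount k false j (n + 1) r + peakCount k true j n (r + k + 2) := by
  simp only [peakCount, sum_raneyWords_succ, peaks, Bool.false_eq_true, if_false, zero_add]

/-- Words ending in `D` have the same peaks with either flag, and words ending in `U` gain one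
if a `D` is to follow. -/
theorem peakCount_true_add (k j n r : ℕ) :
    peakCount k true (j + 1) n (r + 1) + peakCount k false (j + 1) n r =
      peakCount k false j n r + peakCount k false (j + 1) n (r + 1) := by
  rcases n with _ | n
  · rcases r with _ | r
    · simp [peakCount, raneyWords, peaks]
    · simp [peakCount, sum_raneyWords_zero k r, peaks, delta_succ_one_add]
  · simp only [peakCount, sum_raneyWords_succ, peaks, Bool.false_eq_true, if_false, if_true,
      zero_add, delta_succ_one_add]
    ring

theorem peakCount_true_zero_add (k n r : ℕ) :
    peakCount k true 0 n (r + 1) + peakCount k false 0 n r = peakCount k false 0 n (r + 1) := by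
  rcases n with _ | n
  · rcases r with _ | r
    · simp [peakCount, raneyWords, peaks]
    · simp [peakCount, sum_raneyWords_zero k r, peaks, delta_zero_one_add]
  · simp only [peakCount, sum_raneyWords_succ, peaks, Bool.false_eq_true, if_false, if_true,
      zero_add, delta_zero_one_add,
      Finset.sum_const_zero]
    ring

theorem peakCount_false_zero (k j r : ℕ) :
    peakCount k false j 0 (r + 1) = if j = 0 then 1 else 0 := by
  induction r with
  | zero =>
    rw [zero_add, peakCount, raneyWords, Finset.sum_singleton]
    simp [peaks, delta, eq_comm]
  | succ r ih =>
    rw [← ih]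
    simp [peakCount, sum_raneyWords_zero k r, peaks]

theorem peakCount_true_eq_zero (k n r : ℕ) (h : n ≠ 0 → ∀ r, peakCount k false 0 n r = 0)
    (hr : n = 0 → r ≠ 0) : peakCount k true 0 n (r + 1) = 0 := by
  have h1 := peakCount_true_zero_add k n r
  rcases n with _ | n
  · obtain ⟨r, rfl⟩ := Nat.exists_eq_succ_of_ne_zero (hr rfl)
    simpa [peakCount_false_zero] using h1
  · simpa [h (by simp)] using h1

theorem peakCount_false_no_peak (k : ℕ) : ∀ n r, peakCount k false 0 (n + 1) r = 0 := by
  intro n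
  induction n with
  | zero =>
    intro r
    induction r with
    | zero => simp
    | succ r ihr => rw [peakCount_false_succ, ihr, zero_add, peakCount_true_eq_zero] <;> simp
  | succ n ih =>
    intro r
    induction r with
    | zero => simp
    | succ r ihr =>
      rw [peakCount_false_succ, ihr, zero_add, peakCount_true_eq_zero]
      · exact fun _ => ih
      · simp

theorem choose_succ_succ_mul (N i : ℕ) :
    ((N + 1).choose (i + 1) : ℚ) * (i + 1) = (N + 1) * N.choose i := by
  exact_mod_cast (Nat.add_one_mul_choose_eq N i).symm

theorem choose_succ_mul (N i : ℕ) :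
    (N.choose (i + 1) : ℚ) * (i + 1) = (N - i) * N.choose i := by
  have h1 := choose_succ_succ_mul N i
  have h2 : ((N + 1).choose (i + 1) : ℚ) = N.choose i + N.choose (i + 1) := by
    exact_mod_cast Nat.choose_succ_succ N i
  rw [h2] at h1
  linarith

/-- The number of words with `i + 1` peaks when a further `D` follows, from the formula for words
with the same number `n` of letters `D` when none does (the hypothesis `hF`, which is proved from
the present formula by induction on `n`). Here `N + 1` is the number of letters `U`. -/
theorem peakCount_true_formula (k n h i N : ℕ) (hN : N + 1 = (k + 1) * n + h)
    (hF : n ≠ 0 → ∀ r i N : ℕ, N + 1 = (k + 1) * n + r →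
      n * peakCount k false (i + 1) n r = r * n.choose (i + 1) * N.choose i) :
    ((n : ℚ) + 1) * peakCount k true (i + 1) n (h + 1) =
      (n + 1).choose (i + 1) *
        (((h : ℚ) - k) * (N + 1).choose i - ((h : ℚ) - k - 1) * N.choose i) := by
  have key := peakCount_true_add k i n h
  rcases n with _ | n
  · obtain rfl : h = N + 1 := by omega
    simp only [peakCount_false_zero] at key
    rcases i with _ | i
    · simp at key ⊢
      linarith
    · simp at key
      simp [key, Nat.choose_eq_zero_of_lt]
  · have hF := hF (by simp)
    have f1 := hF h i N hN
    have f2 := hF (h + 1) i (N + 1) (by rw [hN]; ring)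
    rcases i with _ | i
    · rw [peakCount_false_no_peak] at key
      simp at *
      have hn : (n : ℚ) + 1 ≠ 0 := by positivity
      have f1' := mul_left_cancel₀ hn (f1.trans (mul_comm _ _))
      have f2' := mul_left_cancel₀ hn (f2.trans (mul_comm _ _))
      have : peakCount k true 1 (n + 1) (h + 1) = 1 := by linarith
      rw [this]
      ring
    · have f3 := hF h i N hN
      have hn : ((n + 1 : ℕ) : ℚ) ≠ 0 := by positivity
      have hi : (i : ℚ) + 1 ≠ 0 := by positivity
      have hi' : (i : ℚ) + 2 ≠ 0 := by positivity
      have hk : (N : ℚ) + 1 = (k + 1) * (n + 1 : ℕ) + h := by exact_mod_cast hN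
      -- All binomial coefficients are multiples of `(n + 1).choose (i + 1)` and `N.choose i`;
      -- what remains is a rational identity, once `h` is eliminated by `hk`.
      have c1 := eq_div_of_mul_eq hi (choose_succ_mul N i)
      have c2 := eq_div_of_mul_eq hi (choose_succ_succ_mul N i)
      have c3 : ((n + 1).choose (i + 2) : ℚ) = _ := eq_div_of_mul_eq (c := ((i + 1 : ℕ) : ℚ) + 1)
        (by positivity) (choose_succ_mul (n + 1) (i + 1))
      have c4 : ((n + 2).choose (i + 2) : ℚ) = _ := eq_div_of_mul_eq (c := ((i + 1 : ℕ) : ℚ) + 1)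
        (by positivity) (choose_succ_succ_mul (n + 1) (i + 1))
      rw [c1, c3] at f1
      rw [c2, c3] at f2
      rw [c1, c2, c4, show (h : ℚ) = N + 1 - (k + 1) * (n + 1 : ℕ) by linarith]
      rw [show (h : ℚ) = N + 1 - (k + 1) * (n + 1 : ℕ) by linarith] at f1 f3
      push_cast at f1 f2 f3 hn ⊢
      rw [show (h : ℚ) = N + 1 - (k + 1) * (n + 1) by push_cast at hk; linarith] at f2
      rw [mul_comm] at f1 f2 f3
      have f1 := eq_div_of_mul_eq hn f1
      have f2 := eq_div_of_mul_eq hn f2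
      have f3 := eq_div_of_mul_eq hn f3
      rw [← eq_sub_iff_add_eq, f1, f2, f3] at key
      rw [key]
      field_simp
      ring

/-- The number of words with `i + 1` peaks: `n.choose (i + 1)` for the letters `D` that end a peak,
`N.choose i` for the ways to split the `N + 1` letters `U` into nonempty runs before these, and the
factor `r / n`, as in the cycle lemma, for the condition on the heights. -/
theorem peakCount_false_formula (k n : ℕ) (hn : n ≠ 0) : ∀ r i N : ℕ, N + 1 = (k + 1) * n + r →
    n * peakCount k false (i + 1) n r = r * n.choose (i + 1) * N.choose i := by
  induction n with
  | zero => exact absurd rfl hn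
  | succ n ih =>
    intro r
    induction r with
    | zero => intro i N _; simp
    | succ r ihr =>
      intro i N hN
      obtain ⟨N, rfl⟩ : ∃ N', N = N' + 1 := ⟨N - 1, by
        have : 0 < (k + 1) * (n + 1) := by positivity
        omega⟩
      have hN' : N + 1 = (k + 1) * (n + 1) + r := by omega
      have h1 := ihr i N hN'
      have h2 := peakCount_true_formula k n (r + k + 1) i N (by rw [hN']; ring) ih
      rw [peakCount_false_succ]
      push_cast at *
      linear_combination h1 + h2

theorem peaks_le (s : List DyckStep) : ∀ b, peaks b s ≤ s.count .D + if b then 1 else 0 := by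
  induction s with
  | nil => simp [peaks]
  | cons a s ih =>
    intro b
    cases a
    · have := ih false
      cases b <;> simp_all [peaks]
      omega
    · have := ih true
      cases b <;> simp_all [peaks]
      omega

/-- The words that correspond to the `k`-box paths of size `m + 1`, sorted by their peaks when a
further `D` follows: the distribution is hypergeometric up to normalization. For the final height
`k`, only one of the two terms of `peakCount_true_formula` is left. -/
theorem sum_peaks (k m N : ℕ) (hN : N + 1 = (k + 1) * m + k) (f : ℕ → ℚ) :
    ∑ s ∈ raneyWords k m (k + 1), f (peaks true s) =
      ∑ i ∈ Finset.range (m + 1), f (i + 1) * ((m + 1).choose (i + 1) * N.choose i / (m + 1)) := by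
  have h1 : ∀ s ∈ raneyWords k m (k + 1),
      f (peaks true s) = ∑ j ∈ Finset.range (m + 2), f j * delta j (peaks true s) := by
    intro s hs
    rw [Finset.sum_eq_single (peaks true s)]
    · simp [delta]
    · intro j _ hj
      simp [delta, hj.symm]
    · intro h
      have h2 := peaks_le s true
      rw [((mem_raneyWords k s m k).1 hs).1] at h2
      simp at h h2
      omega
  rw [Finset.sum_congr rfl h1, Finset.sum_comm, Finset.sum_range_succ']
  simp only [← Finset.mul_sum]
  change ∑ i ∈ _, f (i + 1) * peakCount k true (i + 1) m (k + 1) +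
    f 0 * peakCount k true 0 m (k + 1) = _
  rw [peakCount_true_eq_zero, mul_zero, add_zero]
  · refine Finset.sum_congr rfl fun i _ => ?_
    congr 1
    have := peakCount_true_formula k m k i N hN (fun hm => peakCount_false_formula k m hm)
    rw [eq_div_iff (by positivity)]
    linear_combination this
  · intro hm r
    obtain ⟨m, rfl⟩ := Nat.exists_eq_succ_of_ne_zero hm
    exact peakCount_false_no_peak k m r
  · rintro rfl rfl
    simp at hN

/-! ### Moments of the hypergeometric distribution -/

theorem sum_choose_mul_choose (m N a : ℕ) :
    ∑ i ∈ Finset.range (a + 1), (m.choose (a - i) * N.choose i : ℚ) = (N + m).choose a := by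
  rw [Nat.add_choose_eq, Finset.Nat.sum_antidiagonal_eq_sum_range_succ_mk]
  push_cast
  exact Finset.sum_congr rfl fun i _ => mul_comm _ _

theorem sum_hypergeometric_zero (m N : ℕ) :
    ∑ i ∈ Finset.range (m + 1), ((m + 1).choose (i + 1) * N.choose i : ℚ) =
      (N + m + 1).choose m := by
  rw [add_assoc, ← sum_choose_mul_choose]
  refine Finset.sum_congr rfl fun i hi => ?_
  rw [← Nat.choose_symm (n := m + 1) (k := i + 1) (by simpa using hi)]
  simp

theorem sum_hypergeometric_one (m N : ℕ) :
    ∑ i ∈ Finset.range (m + 1), ((i : ℚ) + 1) * ((m + 1).choose (i + 1) * N.choose i) =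
      (m + 1) * (N + m).choose m := by
  rw [← sum_choose_mul_choose, Finset.mul_sum]
  refine Finset.sum_congr rfl fun i hi => ?_
  rw [Nat.choose_symm (n := m) (k := i) (by simpa [Nat.lt_succ_iff] using hi)]
  linear_combination (N.choose i : ℚ) * choose_succ_succ_mul m i

theorem sum_hypergeometric_two (m N : ℕ) :
    ∑ i ∈ Finset.range (m + 2),
        ((i : ℚ) + 1) * i * ((m + 2).choose (i + 1) * N.choose i) =
      (m + 2) * (m + 1) * (N + m).choose (m + 1) := by
  rw [Finset.sum_range_succ', ← sum_choose_mul_choose m N (m + 1),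
    Finset.sum_range_succ' _ (m + 1), mul_add, Finset.mul_sum]
  congr 1
  · refine Finset.sum_congr rfl fun i hi => ?_
    rw [Nat.add_sub_add_right,
      Nat.choose_symm (n := m) (k := i) (by simpa [Nat.lt_succ_iff] using hi)]
    have h1 := choose_succ_succ_mul (m + 1) (i + 1)
    have h2 := choose_succ_succ_mul m i
    push_cast at h1 ⊢
    linear_combination (N.choose (i + 1) : ℚ) * ((i + 1) * h1 + (m + 2) * h2)
  · simp

/-- Mean and variance of a statistic whose value `i + 1` has frequency proportional to
`(m + 1).choose (i + 1) * N.choose i`: this is the number of marked elements in a sample of size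
`N + 1` from a population of size `N + m + 1` with `m + 1` marked elements. -/
theorem mean_variance_of_hypergeometric {α : Type*} (S : Finset α) (X : α → ℕ) (m N : ℕ)
    (h : ∀ f : ℕ → ℚ, ∑ a ∈ S, f (X a) = ∑ i ∈ Finset.range (m + 1),
      f (i + 1) * ((m + 1).choose (i + 1) * N.choose i / (m + 1))) :
    mean S (fun a => (X a : ℚ)) = (m + 1) * (N + 1) / (N + m + 1) ∧
    variance S (fun a => (X a : ℚ)) =
      (N + 1) * N * (m + 1) * m / ((N + m + 1) ^ 2 * (N + m)) := by
  have e0 : (S.card : ℚ) * (m + 1) = (N + m + 1).choose m := by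
    have := h fun _ => 1
    simp only [one_mul, ← Finset.sum_div, sum_hypergeometric_zero] at this
    simpa [eq_div_iff (show (m : ℚ) + 1 ≠ 0 by positivity)] using this
  have e1 : ∑ a ∈ S, (X a : ℚ) = (N + m).choose m := by
    have := h fun x => x
    simp only [mul_div_assoc', ← Finset.sum_div] at this
    push_cast at this
    rw [this, sum_hypergeometric_one]
    field_simp
  have e2 : (∑ a ∈ S, (X a : ℚ) * (X a - 1)) * (N + m) = m * N * (N + m).choose m := by
    have := h fun x => x * (x - 1)
    simp only [mul_div_assoc', ← Finset.sum_div] at this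
    push_cast at this
    simp only [add_sub_cancel_right] at this
    rw [this]
    rcases m with _ | m
    · simp
    · have c1 := Nat.choose_mul_succ_eq (N + m) (m + 1)
      rw [show N + m + 1 - (m + 1) = N by omega] at c1
      have c1 : ((N + m).choose (m + 1) : ℚ) * (N + m + 1) = (N + (m + 1)).choose (m + 1) * N := by
        exact_mod_cast c1
      rw [sum_hypergeometric_two]
      push_cast
      field_simp
      linear_combination (m + 2 : ℚ) * c1
  have c0 : ((N + m).choose m : ℚ) * (N + m + 1) = (N + m + 1).choose m * (N + 1) := by
    have := Nat.choose_mul_succ_eq (N + m) m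
    rw [show N + m + 1 - m = N + 1 by omega] at this
    exact_mod_cast this
  have hS : (S.card : ℚ) ≠ 0 := by
    intro h0
    rw [h0, zero_mul] at e0
    exact (Nat.choose_pos (show m ≤ N + m + 1 by omega)).ne (by exact_mod_cast e0)
  have hT : (N : ℚ) + m + 1 ≠ 0 := by positivity
  have hmean : mean S (fun a => (X a : ℚ)) = (m + 1) * (N + 1) / (N + m + 1) := by
    rw [mean, e1, div_eq_div_iff hS hT, c0, ← e0]
    ring
  refine ⟨hmean, ?_⟩
  have hvar : variance S (fun a => (X a : ℚ)) =
      (∑ a ∈ S, (X a : ℚ) * (X a - 1)) / S.card + mean S (fun a => (X a : ℚ)) -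
        mean S (fun a => (X a : ℚ)) ^ 2 := by
    have hsum := (div_eq_iff hS).1 (rfl : mean S (fun a => (X a : ℚ)) = mean S _)
    unfold variance
    generalize mean S (fun a => (X a : ℚ)) = μ at hsum ⊢
    have h1 : ∀ a ∈ S, ((X a : ℚ) - μ) ^ 2 = X a * (X a - 1) + (1 - 2 * μ) * X a + μ ^ 2 :=
      fun a _ => by ring
    rw [mean, Finset.sum_congr rfl h1, Finset.sum_add_distrib, Finset.sum_add_distrib,
      ← Finset.mul_sum, hsum, Finset.sum_const, nsmul_eq_mul]
    field_simp
    ring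
  rw [hvar, hmean]
  -- For a population of size `1` the claimed variance is `0 / 0 = 0`, which is correct.
  rcases Nat.eq_zero_or_pos (N + m) with h0 | h0
  · obtain ⟨rfl, rfl⟩ : N = 0 ∧ m = 0 := by omega
    have := h fun x => x * (x - 1)
    simp at this
    simp [this]
  · have hNm : (N : ℚ) + m ≠ 0 := by exact_mod_cast h0.ne'
    have e3 : (∑ a ∈ S, (X a : ℚ) * (X a - 1)) / S.card =
        (m + 1) * m * (N + 1) * N / ((N + m + 1) * (N + m)) := by
      rw [div_eq_div_iff hS (by positivity)]
      linear_combination (N + m + 1 : ℚ) * e2 + m * N * c0 - m * N * (N + 1) * e0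
    rw [e3]
    field_simp
    ring

/-! ### Box paths from Raney words -/

/-- The word obtained from a word over `{U, D}` by replacing each `D` with `U D^k L D`. -/
def expand (k : ℕ) (v : List DyckStep) : List Step :=
  v.flatMap fun s =>
    match s with
    | .U => [U]
    | .D => boxFactor k ++ [D]

/-- The word encoded by the reversal `s` of a word `v`: the expansion of `v`, followed by a last box
`U D^k L`. -/
def toPath (k : ℕ) (s : List DyckStep) : List Step :=
  expand k s.reverse ++ boxFactor k

@[simp] theorem expand_nil (k : ℕ) : expand k [] = [] := rfl

@[simp] theorem expand_cons_U (k : ℕ) (v : List DyckStep) :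
    expand k (.U :: v) = U :: expand k v := rfl

@[simp] theorem expand_cons_D (k : ℕ) (v : List DyckStep) :
    expand k (.D :: v) = boxFactor k ++ D :: expand k v := by
  simp [expand]

theorem expand_append (k : ℕ) (v v' : List DyckStep) :
    expand k (v ++ v') = expand k v ++ expand k v' :=
  List.flatMap_append

theorem boxFactor_append (k : ℕ) (y : List Step) :
    boxFactor k ++ y = U :: (List.replicate k D ++ L :: y) := by
  simp [boxFactor]

theorem replicate_D_append_ne_expand (k : ℕ) (y : List Step) (v : List DyckStep) :
    List.replicate k D ++ L :: y ≠ expand k v := by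
  rcases v with _ | ⟨_ | _, v⟩ <;> rcases k with _ | k <;>
    simp [List.replicate_succ, boxFactor]

theorem expand_injective (k : ℕ) : Function.Injective (expand k) := by
  intro v
  induction v with
  | nil => rintro (_ | ⟨_ | _, v'⟩) h <;> simp [boxFactor] at h ⊢
  | cons a v ih =>
    rintro (_ | ⟨b, v'⟩) h
    · cases a <;> simp [boxFactor] at h
    · cases a <;> cases b
      · rw [ih (List.cons.inj h).2]
      · rw [expand_cons_U, expand_cons_D, boxFactor_append] at h
        exact absurd (List.cons.inj h).2.symm (replicate_D_append_ne_expand k _ v)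
      · rw [expand_cons_U, expand_cons_D, boxFactor_append] at h
        exact absurd (List.cons.inj h).2 (replicate_D_append_ne_expand k _ v')
      · rw [expand_cons_D, expand_cons_D, List.append_cancel_left_eq] at h
        rw [ih (List.cons.inj h).2]

theorem toPath_injective (k : ℕ) : Function.Injective (toPath k) := fun _ _ h =>
  List.reverse_injective (expand_injective k (List.append_cancel_right h))

/-! ### Long ascents are peaks -/

theorem longAscents_append_cons (x y : List Step) {a : Step} (ha : a ≠ U) :
    longAscents (x ++ a :: y) = longAscents x + longAscents y := by
  rw [longAscents, List.splitOnP_append_cons _ _ (by simpa using ha), List.countP_append]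
  rfl

theorem longAscents_nil : longAscents [] = 0 := by
  simp [longAscents]

theorem longAscents_replicate_U (a : ℕ) :
    longAscents (List.replicate a U) = if 2 ≤ a then 1 else 0 := by
  rw [longAscents, List.splitOnP_eq_singleton (by simp)]
  simp [List.countP_singleton]

theorem longAscents_append_boxFactor (k : ℕ) (x : List Step) :
    longAscents (x ++ boxFactor k) = longAscents (x ++ [U]) := by
  have h : ∀ k, longAscents (x ++ [U] ++ List.replicate k D) = longAscents (x ++ [U]) := by
    intro k
    induction k with
    | zero => simp
    | succ k ih =>
      rw [List.replicate_succ', ← List.append_assoc, longAscents_append_cons _ _ (by simp), ih,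
        longAscents_nil, add_zero]
  rw [boxFactor, ← List.append_assoc, ← List.append_assoc, longAscents_append_cons _ _ (by simp), h,
    longAscents_nil, add_zero]

/-- The flag of `peaks` tells an ascent that so far has one step from a longer one, for which
further up steps do not matter. -/
theorem longAscents_expand_reverse (k : ℕ) (s : List DyckStep) :
    longAscents (expand k s.reverse ++ [U]) = peaks true s ∧
      ∀ a, longAscents (expand k s.reverse ++ List.replicate (a + 2) U) = 1 + peaks false s := by
  induction s with
  | nil =>
    refine ⟨?_, fun a => ?_⟩
    · simpa [peaks] using longAscents_replicate_U 1
    · simpa [peaks] using longAscents_replicate_U (a + 2)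
  | cons b s ih =>
    rw [List.reverse_cons, expand_append]
    cases b with
    | U =>
      refine ⟨?_, fun a => ?_⟩
      · simpa [peaks, List.replicate_succ] using ih.2 0
      · simpa [peaks, List.replicate_succ] using ih.2 (a + 1)
    | D =>
      have h : ∀ y, longAscents (expand k s.reverse ++ expand k [.D] ++ y) =
          peaks true s + longAscents y := by
        intro y
        rw [expand_cons_D, expand_nil, ← List.append_assoc, List.append_assoc, List.cons_append,
          longAscents_append_cons _ _ (by simp), longAscents_append_boxFactor, ih.1]
        rfl
      refine ⟨?_, fun a => ?_⟩
      · rw [h, peaks]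
        simpa using longAscents_replicate_U 1
      · rw [h, peaks, longAscents_replicate_U, add_comm]
        simp

theorem longAscents_toPath (k : ℕ) (s : List DyckStep) :
    longAscents (toPath k s) = peaks true s := by
  rw [toPath, longAscents_append_boxFactor, (longAscents_expand_reverse k s).1]

/-! ### Heights -/

/-- The word `l`, whose letters have the increments `wt`, never goes below `0` from height `h`. -/
def StaysAbove {α : Type*} (wt : α → ℤ) (h : ℤ) (l : List α) : Prop :=
  ∀ p, p <+: l → 0 ≤ h + (p.map wt).sum

section
variable {α : Type*} {wt : α → ℤ} {h : ℤ}

theorem StaysAbove.nonneg {l : List α} (H : StaysAbove wt h l) : 0 ≤ h := by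
  simpa using H [] (List.nil_prefix)

theorem staysAbove_nil : StaysAbove wt h [] ↔ 0 ≤ h := by
  simp [StaysAbove]

theorem staysAbove_cons {a : α} {l : List α} :
    StaysAbove wt h (a :: l) ↔ 0 ≤ h ∧ StaysAbove wt (h + wt a) l := by
  refine ⟨fun H => ⟨H.nonneg, fun p hp => ?_⟩, fun H p hp => ?_⟩
  · simpa [add_assoc] using H (a :: p) (by simpa using hp)
  · rcases List.prefix_cons_iff.1 hp with rfl | ⟨t, rfl, ht⟩
    · simpa using H.1
    · simpa [add_assoc] using H.2 t ht

end

/-- The increments of the heights of a skew Dyck path. -/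
def stepHeight : Step → ℤ
  | U => 1
  | D => -1
  | L => -1

/-- The increments of the heights of a Raney word. -/
def raneyHeight (k : ℕ) : DyckStep → ℤ
  | .U => 1
  | .D => -(k + 1)

theorem sum_map_stepHeight (w : List Step) :
    (w.map stepHeight).sum = w.count U - w.count D - w.count L := by
  induction w with
  | nil => simp
  | cons a w ih => cases a <;> simp [ih, stepHeight] <;> ring

theorem sum_map_raneyHeight (k : ℕ) (v : List DyckStep) :
    (v.map (raneyHeight k)).sum = v.count .U - (k + 1) * v.count .D := by
  induction v with
  | nil => simp
  | cons a w ih => cases a <;> simp [ih, raneyHeight] <;> ring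

theorem staysAbove_boxFactor_append (k : ℕ) (h : ℤ) (y : List Step) :
    StaysAbove stepHeight h (boxFactor k ++ y) ↔ 0 ≤ h ∧ StaysAbove stepHeight (h - k) y := by
  have key : ∀ (j : ℕ) (h : ℤ), StaysAbove stepHeight h (List.replicate j D ++ L :: y) ↔
      StaysAbove stepHeight (h - j - 1) y := by
    intro j
    induction j with
    | zero =>
      intro h
      simp only [List.replicate_zero, List.nil_append, staysAbove_cons, stepHeight, Nat.cast_zero,
        sub_zero, ← sub_eq_add_neg]
      refine ⟨And.right, fun H => ⟨?_, H⟩⟩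
      linarith [H.nonneg]
    | succ j ih =>
      intro h
      rw [List.replicate_succ, List.cons_append, staysAbove_cons, ih]
      have e : h + stepHeight D - j - 1 = h - (j + 1 : ℕ) - 1 := by
        simp only [stepHeight]
        push_cast
        ring
      rw [e]
      refine ⟨And.right, fun H => ⟨?_, H⟩⟩
      have := H.nonneg
      push_cast at this
      linarith
  rw [boxFactor_append, staysAbove_cons, key]
  have e : h + stepHeight U - k - 1 = h - k := by
    simp only [stepHeight]
    ring
  rw [e]

theorem staysAbove_expand_append (k : ℕ) (v : List DyckStep) (y : List Step) : ∀ h : ℤ,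
    StaysAbove stepHeight h (expand k v ++ y) ↔
      StaysAbove (raneyHeight k) h v ∧
        StaysAbove stepHeight (h + (v.map (raneyHeight k)).sum) y := by
  induction v with
  | nil =>
    intro h
    rw [staysAbove_nil]
    simpa using fun H => StaysAbove.nonneg H
  | cons a v ih =>
    intro h
    cases a with
    | U =>
      rw [expand_cons_U, List.cons_append, staysAbove_cons, ih, staysAbove_cons, and_assoc,
        List.map_cons, List.sum_cons, add_assoc]
      rfl
    | D =>
      rw [expand_cons_D, List.append_assoc, staysAbove_boxFactor_append, List.cons_append,
        staysAbove_cons, ih, staysAbove_cons, List.map_cons, List.sum_cons]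
      have e : h - k + stepHeight D = h + raneyHeight k .D := by
        simp only [stepHeight, raneyHeight]
        ring
      rw [e, add_assoc]
      refine ⟨fun H => ⟨⟨H.1, H.2.2.1⟩, H.2.2.2⟩, fun H => ⟨H.1.1, ?_, H.1.2, H.2⟩⟩
      have := H.1.2.nonneg
      simp only [raneyHeight] at this
      linarith

theorem staysAbove_stepHeight_zero (w : List Step) :
    StaysAbove stepHeight 0 w ↔
      ∀ p : List Step, p <+: w → p.count D + p.count L ≤ p.count U := by
  refine forall₂_congr fun p _ => ?_
  rw [sum_map_stepHeight]
  omega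

theorem staysAbove_raneyHeight_zero (k : ℕ) (s : List DyckStep) :
    StaysAbove (raneyHeight k) 0 s.reverse ↔
      ∀ t, t <:+ s → (k + 1) * t.count .D ≤ t.count .U := by
  have key : ∀ t : List DyckStep, 0 ≤ 0 + (t.map (raneyHeight k)).sum ↔
      (k + 1) * t.count .D ≤ t.count .U := by
    intro t
    rw [sum_map_raneyHeight]
    zify
    constructor <;> intro <;> linarith
  constructor
  · intro H t ht
    simpa using (key _).1 (H t.reverse (List.reverse_prefix.2 ht))
  · intro H p hp
    refine (key p).2 ?_
    simpa using H p.reverse (by simpa using List.reverse_suffix.2 hp)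

/-! ### Box factors -/

theorem factorCount_cons (v : List Step) (a : Step) (w : List Step) :
    factorCount v (a :: w) = factorCount v w + if v <+: a :: w then 1 else 0 := by
  simp [factorCount, List.countP_cons]

theorem factorCount_boxFactor_nil (k : ℕ) : factorCount (boxFactor k) [] = 0 := by
  simp [factorCount, boxFactor]

theorem factorCount_boxFactor_cons {k : ℕ} {a : Step} (ha : a ≠ U) (w : List Step) :
    factorCount (boxFactor k) (a :: w) = factorCount (boxFactor k) w := by
  rw [factorCount_cons, if_neg, add_zero]
  simp [boxFactor, ha.symm]

theorem factorCount_boxFactor_append (k : ℕ) (y : List Step) :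
    factorCount (boxFactor k) (boxFactor k ++ y) = factorCount (boxFactor k) y + 1 := by
  have h : ∀ j, factorCount (boxFactor k) (List.replicate j D ++ L :: y) =
      factorCount (boxFactor k) y := by
    intro j
    induction j with
    | zero => exact factorCount_boxFactor_cons (by simp) y
    | succ j ih =>
      rw [List.replicate_succ, List.cons_append, factorCount_boxFactor_cons (by simp), ih]
  rw [boxFactor_append]
  rw [factorCount_cons, h, if_pos]
  rw [← boxFactor_append]
  exact List.prefix_append _ _

theorem expand_append_boxFactor_eq_cons (k : ℕ) (v : List DyckStep) :
    ∃ y, expand k v ++ boxFactor k = U :: y := by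
  rcases v with _ | ⟨_ | _, v⟩ <;> simp [boxFactor]

theorem factorCount_expand (k : ℕ) (v : List DyckStep) :
    factorCount (boxFactor (k + 1)) (expand (k + 1) v ++ boxFactor (k + 1)) = v.count .D + 1 := by
  induction v with
  | nil =>
    have := factorCount_boxFactor_append (k + 1) []
    rw [List.append_nil, factorCount_boxFactor_nil] at this
    simpa using this
  | cons a v ih =>
    cases a with
    | U =>
      rw [expand_cons_U, List.cons_append, factorCount_cons, ih, if_neg]
      · simp
      · obtain ⟨y, hy⟩ := expand_append_boxFactor_eq_cons (k + 1) v
        rw [hy]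
        simp [boxFactor, List.replicate_succ]
    | D =>
      rw [expand_cons_D, List.append_assoc, factorCount_boxFactor_append, List.cons_append,
        factorCount_boxFactor_cons (by simp), ih, List.count_cons_self]

theorem count_U_expand (k : ℕ) (v : List DyckStep) :
    (expand k v ++ boxFactor k).count U = v.count .U + v.count .D + 1 := by
  induction v with
  | nil => simp [boxFactor, List.count_replicate]
  | cons a v ih =>
    cases a <;> simp [boxFactor, List.count_replicate] at ih ⊢ <;> omega

theorem count_D_add_count_L_expand (k : ℕ) (v : List DyckStep) :
    (expand k v ++ boxFactor k).count D + (expand k v ++ boxFactor k).count L + 1 =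
      (k + 2) * (v.count .D + 1) := by
  induction v with
  | nil =>
    simp [boxFactor, List.count_replicate]
  | cons a v ih =>
    cases a <;> simp [boxFactor, List.count_replicate] at ih ⊢ <;> linarith

/-- In a word without factors `LU`, every factor `U D^k L` but a final one is followed by a further
down or left step. So the box factors use up `k + 2` such steps each, with one missing at the end,
and if these are all such steps, then the word is a sequence of `U`s and of `U D^k L D`s, with the
last `D` removed. -/
theorem factorCount_le_and_eq (k : ℕ) (w : List Step) (hw : ¬ [L, U] <:+: w) :
    (k + 2) * factorCount (boxFactor k) w ≤ w.count D + w.count L + 1 ∧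
      ((k + 2) * factorCount (boxFactor k) w = w.count D + w.count L + 1 →
        ∃ v, w = expand k v ++ boxFactor k) := by
  induction hl : w.length using Nat.strong_induction_on generalizing w with
  | _ l ih =>
    subst hl
    by_cases hb : boxFactor k <+: w
    · obtain ⟨r, rfl⟩ := hb
      rw [factorCount_boxFactor_append]
      have hD : (boxFactor k ++ r).count D + (boxFactor k ++ r).count L =
          r.count D + r.count L + (k + 1) := by
        simp [boxFactor, List.count_replicate]
        ring
      rw [hD]
      have hLr : [L] ++ r <:+: boxFactor k ++ r :=
        ⟨U :: List.replicate k D, [], by simp [boxFactor]⟩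
      rcases r with _ | ⟨a, r⟩
      · rw [factorCount_boxFactor_nil]
        exact ⟨by simp, fun _ => ⟨[], by simp⟩⟩
      · have hU : a ≠ U := by
          rintro rfl
          exact hw (List.IsInfix.trans ⟨[], r, rfl⟩ hLr)
        have hr : r <:+: boxFactor k ++ a :: r := List.IsInfix.trans ⟨[L, a], [], by simp⟩ hLr
        obtain ⟨h1, h2⟩ := ih r.length (by simp; omega) r (fun h => hw (h.trans hr)) rfl
        rw [factorCount_boxFactor_cons hU]
        have hc : (a :: r).count D + (a :: r).count L = r.count D + r.count L + 1 := by
          cases a <;> simp at hU ⊢ <;> omega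
        rw [hc]
        refine ⟨by linarith, fun h => ?_⟩
        obtain ⟨v, rfl⟩ := h2 (by linarith)
        cases a with
        | U => exact absurd rfl hU
        | D => exact ⟨.D :: v, by simp⟩
        | L =>
          -- This `L` would be followed by the first letter of the rest, which is a `U`.
          obtain ⟨y, hy⟩ := expand_append_boxFactor_eq_cons k v
          refine absurd (List.IsInfix.trans ⟨[L], y, ?_⟩ hLr) hw
          rw [hy]
          rfl
    · rcases w with _ | ⟨a, w⟩
      · simp [factorCount_boxFactor_nil]
      · have hi : w <:+: a :: w := (List.suffix_cons a w).isInfix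
        obtain ⟨h1, h2⟩ := ih w.length (by simp) w (fun h => hw (h.trans hi)) rfl
        rw [factorCount_cons, if_neg hb, add_zero]
        cases a with
        | U =>
          simp only [List.count_cons_of_ne, ne_eq, reduceCtorEq, not_false_eq_true]
          refine ⟨h1, fun h => ?_⟩
          obtain ⟨v, rfl⟩ := h2 h
          exact ⟨.U :: v, rfl⟩
        | D =>
          simp
          exact ⟨by omega, by omega⟩
        | L =>
          simp
          exact ⟨by omega, by omega⟩

/-- Neither a factor `UL` nor a factor `LU` starts at the first of two consecutive letters. -/
def Compatible (a b : Step) : Prop :=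
  ¬ (a = U ∧ b = L) ∧ ¬ (a = L ∧ b = U)

theorem isChain_expand (k : ℕ) (v : List DyckStep) :
    (expand (k + 1) v ++ boxFactor (k + 1)).IsChain Compatible := by
  have hbox : (boxFactor (k + 1)).IsChain Compatible := by
    have := List.isChain_replicate_of_rel (r := Compatible) (k + 1) (a := D) (by simp [Compatible])
    rw [boxFactor, List.append_assoc, List.isChain_append, List.isChain_append]
    simp [this, Compatible, List.getLast?_replicate, List.head?_replicate]
  induction v with
  | nil => simpa using hbox
  | cons a v ih =>
    obtain ⟨y, hy⟩ := expand_append_boxFactor_eq_cons (k + 1) v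
    rw [hy] at ih
    cases a with
    | U =>
      rw [expand_cons_U, List.cons_append, hy, List.isChain_cons_cons]
      exact ⟨by simp [Compatible], ih⟩
    | D =>
      rw [expand_cons_D, List.append_assoc, List.cons_append, hy, List.isChain_append,
        List.isChain_cons_cons]
      refine ⟨hbox, ⟨by simp [Compatible], ih⟩, ?_⟩
      simp [Compatible]

/-! ### The enumeration of box paths -/

theorem isBoxPath_iff (k m : ℕ) (w : List Step) :
    IsBoxPath k (m + 1) w ↔ ∃ s ∈ raneyWords k m (k + 1), toPath k s = w := by
  simp only [mem_raneyWords]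
  rcases k with _ | k
  · constructor
    · rintro ⟨d, hd, rfl⟩
      refine ⟨d.toList.reverse, ⟨?_, ?_, ?_⟩, ?_⟩
      · rw [List.count_reverse, ← d.count_U_eq_count_D]
        exact Nat.succ_injective hd
      · rw [List.count_reverse, zero_add, one_mul, add_zero]
        exact Nat.succ_injective hd
      · rw [← staysAbove_raneyHeight_zero, List.reverse_reverse]
        intro p hp
        rw [List.prefix_iff_eq_take.1 hp, sum_map_raneyHeight]
        have := d.count_D_le_count_U p.length
        push_cast
        omega
      · rw [toPath, List.reverse_reverse]
        rfl
    · rintro ⟨s, ⟨h1, h2, h3⟩, rfl⟩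
      refine ⟨⟨s.reverse, by simp [h1, h2], fun i => ?_⟩, ?_, rfl⟩
      · have := h3 (s.reverse.take i).reverse (by
          rw [← List.reverse_prefix, List.reverse_reverse]
          exact List.take_prefix _ _)
        simpa using this
      · simpa [DyckWord.semilength] using h2
  · constructor
    · rintro ⟨⟨-, hLU, hcount, hpre⟩, hsl, hfc⟩
      obtain ⟨v, rfl⟩ := (factorCount_le_and_eq (k + 1) w hLU).2 (by rw [hfc, ← hcount, hsl])
      rw [factorCount_expand] at hfc
      have hU := count_U_expand (k + 1) v
      refine ⟨v.reverse, ⟨?_, ?_, ?_⟩, by rw [toPath, List.reverse_reverse]⟩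
      · rw [List.count_reverse]
        omega
      · rw [List.count_reverse]
        have : v.count .D = m := by omega
        nlinarith
      · rw [← staysAbove_raneyHeight_zero, List.reverse_reverse]
        rw [← staysAbove_stepHeight_zero, staysAbove_expand_append] at hpre
        exact hpre.1
    · rintro ⟨s, ⟨h1, h2, h3⟩, rfl⟩
      have hch := isChain_expand k s.reverse
      have hU := count_U_expand (k + 1) s.reverse
      have hD := count_D_add_count_L_expand (k + 1) s.reverse
      simp only [List.count_reverse, h1, h2] at hU hD
      refine ⟨⟨fun h => ?_, fun h => ?_, ?_, ?_⟩, ?_, ?_⟩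
      · simpa [Compatible] using hch.infix h
      · simpa [Compatible] using hch.infix h
      · rw [toPath]
        nlinarith
      · rw [← staysAbove_stepHeight_zero, toPath, staysAbove_expand_append,
          staysAbove_raneyHeight_zero]
        refine ⟨h3, ?_⟩
        rw [← List.append_nil (boxFactor (k + 1)), staysAbove_boxFactor_append, staysAbove_nil,
          sum_map_raneyHeight, List.count_reverse, List.count_reverse, h1, h2]
        push_cast
        constructor <;> linarith
      · rw [toPath]
        nlinarith
      · rw [toPath, factorCount_expand, List.count_reverse, h1]

theorem boxPaths_eq_map (k m : ℕ) :
    boxPaths k (m + 1) = (raneyWords k m (k + 1)).map ⟨toPath k, toPath_injective k⟩ := by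
  ext w
  simp [boxPaths, isBoxPath_iff]

end BoxPath

theorem proposition7p4 (k n : ℕ) (hn : 1 ≤ n) (hkn : ¬ (k = 0 ∧ n = 1)) :
    BoxPath.mean (BoxPath.boxPaths k n) (fun w => (BoxPath.longAscents w : ℚ)) =
      (n : ℚ) * (((k : ℚ) + 1) * n - 1) / (((k : ℚ) + 2) * n - 2) ∧
    (¬ (k = 1 ∧ n = 1) →
      BoxPath.variance (BoxPath.boxPaths k n) (fun w => (BoxPath.longAscents w : ℚ)) =
        ((((k : ℚ) + 1) * n - 1) * (((k : ℚ) + 1) * n - 2) * n * ((n : ℚ) - 1)) /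
          ((((k : ℚ) + 2) * n - 2) ^ 2 * (((k : ℚ) + 2) * n - 3))) ∧
    (k = 1 ∧ n = 1 →
      BoxPath.variance (BoxPath.boxPaths k n) (fun w => (BoxPath.longAscents w : ℚ)) = 0) := by
  obtain ⟨m, rfl⟩ : ∃ m, n = m + 1 := ⟨n - 1, by omega⟩
  obtain ⟨N, hN⟩ : ∃ N, N + 1 = (k + 1) * m + k := by
    refine ⟨(k + 1) * m + k - 1, Nat.sub_add_cancel ?_⟩
    rcases m with _ | m
    · omega
    · nlinarith
  obtain ⟨h1, h2⟩ := BoxPath.mean_variance_of_hypergeometric (BoxPath.boxPaths k (m + 1))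
    BoxPath.longAscents m N fun f => by
      rw [BoxPath.boxPaths_eq_map, Finset.sum_map, ← BoxPath.sum_peaks k m N hN f]
      exact Finset.sum_congr rfl fun s _ => by
        rw [Function.Embedding.coeFn_mk, BoxPath.longAscents_toPath]
  have hN' : (N : ℚ) = (k + 1) * m + k - 1 := by
    rw [eq_sub_iff_add_eq]
    exact_mod_cast hN
  have e1 : ((k : ℚ) + 1) * (m + 1 : ℕ) - 1 = N + 1 := by rw [hN']; push_cast; ring
  have e2 : ((k : ℚ) + 1) * (m + 1 : ℕ) - 2 = N := by rw [hN']; push_cast; ring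
  have e3 : ((k : ℚ) + 2) * (m + 1 : ℕ) - 2 = N + m + 1 := by rw [hN']; push_cast; ring
  have e4 : ((k : ℚ) + 2) * (m + 1 : ℕ) - 3 = N + m := by rw [hN']; push_cast; ring
  refine ⟨?_, fun _ => ?_, ?_⟩
  · rw [h1, e1, e3]
    push_cast
    rfl
  · rw [h2, e1, e2, e3, e4]
    push_cast
    rw [add_sub_cancel_right]
  · rintro ⟨-, hm⟩
    rw [h2, Nat.succ_injective hm]
    simp
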